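/- Let $S$ be a closed connected Riemann surface and let $G$ be a finite group acting faithfully on $S$ by holomorphic maps. Let $T=S/G$, with quotient map $\pi:S\to T$, carry the complex structure making $\pi$ holomorphic; the \emph{cone points} of $T$ are the images of the points of $S$ with non-trivial stabilizer, and all other points of $T$ are \emph{regular}. A \emph{cut system} $\mathcal E$ on $T$ is an embedded finite graph in $T$ (loops and multiple edges allowed) such that: the vertex set contains all cone points; the $k$ edges are smooth regular arcs with definite (one-sided) tangents at their end points; the edges have no self-intersections and meet each other only at vertices; distinct edge ends at a common vertex have distinct tangent directions; no regular point is a vertex of valency one; and $T\setminus\mathcal E$ is an open disc. The \emph{open polygons} of the lifted tiling of $S$ are the connected components of $S\setminus\pi^{-1}(\mathcal E)$, and its \emph{polygons} are their closures. The \emph{edges} of the tiling are the connected components of the sets $\pi^{-1}(e^\circ)$, where $e^\circ$ is the interior of an edge $e$ of $\mathcal E$. Two polygons \emph{meet in} an edge of the tiling if both contain it. Fix $x_0\in S$ with $v_0=\pi(x_0)\notin\mathcal E$. For a loop $\gamma$ at $v_0$ avoiding the cone points, the \emph{monodromy} $\xi(\gamma)$ is the unique $g\in G$ such that the lift of $\gamma$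 to $S$ starting at $x_0$ ends at $g x_0$. For every edge $e$ of $\mathcal E$ let $\delta_e$ be a \emph{crossover loop}: a simple loop at $v_0$ that meets $\mathcal E$ exactly once, at an interior point of $e$, where it crosses $e$ transversally. The two orientations of $e$ have the \emph{crossover transformations} $\xi(\delta_e)$ and $\xi(\delta_e^{-1})$, and the \emph{crossover sequence} lists, in any order, the crossover transformations of the $2k$ oriented edges of $\mathcal E$. If the crossover sequence contains an involution (an element of order $2$), then for every polygon of the tiling there is at least one other polygon (coming from a different open polygon) which it meets in two or more edges. -/

import Mathlib

open scoped Manifold ContDiff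
open Set

/-- The orbit space `T = S / G`, with the quotient topology. -/
abbrev OrbitSurface (G S : Type*) [Group G] [MulAction G S] : Type _ :=
  MulAction.orbitRel.Quotient G S

namespace OrbitSurface

variable {G S : Type*} [Group G] [MulAction G S]

/-- The quotient map `π_G : S → S / G`. -/
def proj (G : Type*) {S : Type*} [Group G] [MulAction G S] (x : S) : OrbitSurface G S :=
  Quotient.mk _ x

/-- The cone points of `S / G`: the images of the points with non-trivial stabilizer. -/
def conePoints (G S : Type*) [Group G] [MulAction G S] : Set (OrbitSurface G S) :=
  proj G '' {x : S | MulAction.stabilizer G x ≠ ⊥}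

variable [TopologicalSpace S]

/-- `γ`, a loop at `π_G(x₀)`, has a lift to `S` that starts at `x₀` and ends at `g x₀`. -/
def LiftsTo (x₀ : S) (γ : Path (proj G x₀) (proj G x₀)) (g : G) : Prop :=
  ∃ γ' : Path x₀ (g • x₀), ∀ t, proj G (γ' t) = γ t

open Classical in
/-- The monodromy `ξ_{x₀}(γ)` of a loop `γ` at `π_G(x₀)` avoiding the cone points: the unique
`g ∈ G` such that the lift of `γ` starting at `x₀` ends at `g x₀`
(see `existsUnique_liftsTo`; the value `1` is only used when there is no such lift). -/
noncomputable def monodromy (x₀ : S) (γ : Path (proj G x₀) (proj G x₀)) : G :=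
  if h : ∃ g : G, LiftsTo x₀ γ g then h.choose else 1

/-- For a loop that avoids the cone points, the monodromy is well defined. -/
theorem existsUnique_liftsTo [Finite G] [T2Space S] [LocallyCompactSpace S]
    [ContinuousConstSMul G S] (x₀ : S) (γ : Path (proj G x₀) (proj G x₀))
    (hγ : ∀ t, γ t ∉ conePoints G S) : ∃! g : G, LiftsTo x₀ γ g := by
  set R : Set (OrbitSurface G S) := proj G '' {x : S | MulAction.stabilizer G x = ⊥} with hR
  have hcov : IsCoveringMap (R.restrictPreimage (proj G : S → OrbitSurface G S)) :=
    IsCoveringMapOn.isCoveringMap_restrictPreimage _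
      (isCoveringMapOn_quotientMk_of_properlyDiscontinuousSMul (G := G) (E := S))
  have hmem : ∀ t, γ t ∈ R := by
    intro t
    obtain ⟨x, hx⟩ := Quotient.exists_rep (γ t)
    refine ⟨x, ?_, hx⟩
    by_contra hne
    exact hγ t ⟨x, hne, hx⟩
  have hx₀R : proj G x₀ ∈ R := by simpa using hmem 0
  have hstab : MulAction.stabilizer G x₀ = ⊥ := by
    by_contra hne
    exact hγ 0 (by rw [γ.source]; exact ⟨x₀, hne, rfl⟩)
  let γR : C(unitInterval, R) := ⟨fun t => ⟨γ t, hmem t⟩, by fun_prop⟩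
  let e : proj G ⁻¹' R := ⟨x₀, hx₀R⟩
  have h0 : γR 0 = R.restrictPreimage (proj G : S → OrbitSurface G S) e :=
    Subtype.ext (by simp [γR, e])
  have key : ∀ t, proj G ((hcov.liftPath γR e h0 t : proj G ⁻¹' R) : S) = γ t := fun t =>
    congrArg Subtype.val (congrFun (hcov.liftPath_lifts γR e h0) t)
  have hend : proj G ((hcov.liftPath γR e h0 1 : proj G ⁻¹' R) : S) = proj G x₀ := by
    rw [key 1]; simp
  obtain ⟨g, hg⟩ : ∃ g : G, g • x₀ = ((hcov.liftPath γR e h0 1 : proj G ⁻¹' R) : S) :=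
    Quotient.exact hend
  refine ⟨g, ⟨⟨⟨fun t => ((hcov.liftPath γR e h0 t : proj G ⁻¹' R) : S), by fun_prop⟩, ?_, ?_⟩,
    key⟩, ?_⟩
  · simp [hcov.liftPath_zero, e]
  · exact hg.symm
  · rintro g' ⟨γ', hγ'⟩
    have hm : ∀ t, γ' t ∈ proj G ⁻¹' R := fun t => by
      rw [mem_preimage, hγ' t]; exact hmem t
    let Γ : C(unitInterval, proj G ⁻¹' R) := ⟨fun t => ⟨γ' t, hm t⟩, by fun_prop⟩
    have hΓ : Γ = hcov.liftPath γR e h0 := by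
      rw [hcov.eq_liftPath_iff']
      refine ⟨funext fun t => Subtype.ext (hγ' t), Subtype.ext ?_⟩
      simp [Γ, e]
    have h1 : g' • x₀ = g • x₀ := by
      rw [hg, ← hΓ]; simp [Γ]
    have h2 : g⁻¹ * g' ∈ MulAction.stabilizer G x₀ := by
      rw [MulAction.mem_stabilizer_iff, mul_smul, h1, inv_smul_smul]
    rw [hstab, Subgroup.mem_bot] at h2
    exact (inv_mul_eq_one.mp h2).symm

/-- The monodromy of a loop that avoids the cone points is given by the end point of its lift. -/
theorem liftsTo_monodromy [Finite G] [T2Space S] [LocallyCompactSpace S]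
    [ContinuousConstSMul G S] (x₀ : S) (γ : Path (proj G x₀) (proj G x₀))
    (hγ : ∀ t, γ t ∉ conePoints G S) : LiftsTo x₀ γ (monodromy x₀ γ) := by
  have h : ∃ g : G, LiftsTo x₀ γ g := (existsUnique_liftsTo x₀ γ hγ).exists
  rw [monodromy, dif_pos h]
  exact h.choose_spec

end OrbitSurface

section Arcs

variable {T : Type*}

/-- The two ends of an arc parametrized by `[0, 1]`: `false` is the start, `true` the end. -/
def arcEnd (f : ℝ → T) (b : Bool) : T := if b then f 1 else f 0

variable [TopologicalSpace T] [ChartedSpace ℂ T]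

/-- The velocity of an arc parametrized by `[0, 1]`, one-sided at the end points. -/
noncomputable def arcVelocity (f : ℝ → T) (t : ℝ) : ℂ :=
  mfderivWithin 𝓘(ℝ, ℝ) 𝓘(ℝ, ℂ) f (Icc 0 1) t (1 : ℝ)

/-- The tangent vector at an end of an arc, pointing from the end point into the arc. -/
noncomputable def arcEndTangent (f : ℝ → T) (b : Bool) : ℂ :=
  if b then -arcVelocity f 1 else arcVelocity f 0

end Arcs

/-- A cut system on a surface `T` with the given set of cone points: an embedded finite graph with
smooth edges whose complement is an open disc.  Edges are parametrized by `[0, 1]`; loops and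
multiple edges are allowed. -/
structure CutSystem (T : Type*) [TopologicalSpace T] [ChartedSpace ℂ T]
    (conePoints : Set T) where
  /-- the number of edges -/
  k : ℕ
  /-- the vertices -/
  vertices : Finset T
  /-- the edges; only the values on `[0, 1]` matter -/
  arc : Fin k → ℝ → T
  conePoints_subset : conePoints ⊆ vertices
  arc_zero_mem : ∀ i, arc i 0 ∈ vertices
  arc_one_mem : ∀ i, arc i 1 ∈ vertices
  /-- no edge passes through a vertex -/
  arc_notMem : ∀ i, ∀ t ∈ Ioo (0 : ℝ) 1, arc i t ∉ vertices
  arc_injOn : ∀ i, InjOn (arc i) (Ioo 0 1)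
  arc_disjoint : ∀ i j, i ≠ j → Disjoint (arc i '' Ioo 0 1) (arc j '' Ioo 0 1)
  arc_smooth : ∀ i, ContMDiffOn 𝓘(ℝ, ℝ) 𝓘(ℝ, ℂ) ∞ (arc i) (Ioo 0 1)
  /-- together with `velocity_ne_zero`: one-sided tangents exist at the end points -/
  arc_mdifferentiableOn : ∀ i, MDifferentiableOn 𝓘(ℝ, ℝ) 𝓘(ℝ, ℂ) (arc i) (Icc 0 1)
  velocity_ne_zero : ∀ i, ∀ t ∈ Icc (0 : ℝ) 1, arcVelocity (arc i) t ≠ 0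
  /-- distinct edge ends at a common vertex leave it in distinct directions -/
  distinct_tangents : ∀ a b : Fin k × Bool, a ≠ b → arcEnd (arc a.1) a.2 = arcEnd (arc b.1) b.2 →
    ¬ SameRay ℝ (arcEndTangent (arc a.1) a.2) (arcEndTangent (arc b.1) b.2)
  /-- a regular point is not a terminal vertex, that is, not a vertex of valency one -/
  not_terminal : ∀ v ∈ vertices, v ∉ conePoints →
    {a : Fin k × Bool | arcEnd (arc a.1) a.2 = v}.ncard ≠ 1
  /-- the complement of the graph is an open disc -/
  compl_disc : Nonempty
    (↥((vertices : Set T) ∪ ⋃ i, arc i '' Icc 0 1)ᶜ ≃ₜ ↥(Metric.ball (0 : ℂ) 1))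

namespace CutSystem

section Base

variable {T : Type*} [TopologicalSpace T] [ChartedSpace ℂ T] {C : Set T} (E : CutSystem T C)

/-- The underlying set of the graph. -/
def carrier : Set T := (E.vertices : Set T) ∪ ⋃ i, E.arc i '' Icc 0 1

/-- The open edge `i`. -/
def openEdge (i : Fin E.k) : Set T := E.arc i '' Ioo 0 1

/-- `δ` is a crossover loop for the edge `i`: a simple loop that meets the graph at exactly one
parameter, in an interior point of the edge `i`, where it crosses the edge transversally. -/
structure IsCrossoverLoop (i : Fin E.k) {v₀ : T} (δ : Path v₀ v₀) : Prop where
  simple : ∀ s t, δ s = δ t → s = t ∨ (s = 0 ∧ t = 1) ∨ (s = 1 ∧ t = 0)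
  crosses : ∃ s ∈ Ioo (0 : ℝ) 1, ∃ u ∈ Ioo (0 : ℝ) 1,
    δ.extend s = E.arc i u ∧
    (∀ t ∈ Icc (0 : ℝ) 1, δ.extend t ∈ E.carrier → t = s) ∧
    MDifferentiableAt 𝓘(ℝ, ℝ) 𝓘(ℝ, ℂ) δ.extend s ∧
    LinearIndependent ℝ
      ![(mfderiv 𝓘(ℝ, ℝ) 𝓘(ℝ, ℂ) δ.extend s (1 : ℝ) : ℂ), arcVelocity (E.arc i) u]

end Base

section Lift

open OrbitSurface

variable {G S : Type*} [Group G] [MulAction G S] [TopologicalSpace S]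
  [ChartedSpace ℂ (OrbitSurface G S)]
  (E : CutSystem (OrbitSurface G S) (conePoints G S))

/-- The lifted graph `π_G⁻¹(E)` on `S`. -/
def lift : Set S := proj G ⁻¹' E.carrier

/-- The open polygons of the tiling: the connected components of `S ∖ π_G⁻¹(E)`. -/
def IsPolygon (Q : Set S) : Prop :=
  ∃ x ∈ E.liftᶜ, Q = connectedComponentIn E.liftᶜ x

/-- The open edges of the tiling: the connected components of the preimages of the open edges. -/
def IsLiftedEdge (e : Set S) : Prop :=
  ∃ i, ∃ x ∈ proj G ⁻¹' E.openEdge i, e = connectedComponentIn (proj G ⁻¹' E.openEdge i) x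

/-- The edges of the tiling in which the closures of `Q` and `Q'` meet. -/
def commonEdges (Q Q' : Set S) : Set (Set S) :=
  {e | E.IsLiftedEdge e ∧ e ⊆ closure Q ∩ closure Q'}

/-- The crossover transformation of an oriented edge, given a choice `δ` of crossover loops:
the monodromy of `δ i` or of its inverse, according to the orientation. -/
noncomputable def crossover {x₀ : S} (δ : Fin E.k → Path (proj G x₀) (proj G x₀))
    (e : Fin E.k × Bool) : G :=
  if e.2 then monodromy x₀ (δ e.1) else monodromy x₀ (δ e.1).symm

/-- The crossover transformation sequence for an ordering of the `2k` oriented edges. -/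
noncomputable def crossoverSequence {x₀ : S} (δ : Fin E.k → Path (proj G x₀) (proj G x₀))
    (ord : Fin (2 * E.k) ≃ Fin E.k × Bool) : Fin (2 * E.k) → G :=
  fun j => E.crossover δ (ord j)

end Lift

end CutSystem

/-! Let `h` be the involution, `P` the open polygon containing `x₀`, and `y` the point where the
lift of the crossover loop from `x₀` to `h x₀` crosses the tiling. Then `y` lies in the closures of
`P` and `hP`. Applying `h` and using `h² = 1`, so does `h y`. Hence the lifted edges through `y` and
`h y` both lie in both polygons, and translating by `G` transfers this to every polygon.

Two facts carry this. The open disc and the open edges are simply connected and consist of regular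
points, so over each of them `proj` splits into sheets, which `G` permutes simply transitively
(`smul_eq_of_connectedComponentIn_eq`, `exists_connectedComponentIn_smul_eq`); this makes the two
polygons distinct, the two edges distinct, and every polygon a translate of `P`. Moreover, a polygon
touching an open edge at one point contains all of it
(`connectedComponentIn_openEdge_subset_closure`), because the graph is locally a straight line
there. -/

/-! ### Coverings over simply connected sets -/

theorem Homeomorph.simplyConnectedSpace {X Y : Type*} [TopologicalSpace X] [TopologicalSpace Y]
    (e : X ≃ₜ Y) [SimplyConnectedSpace Y] : SimplyConnectedSpace X :=
  e.toHomotopyEquiv.simplyConnectedSpace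

theorem Homeomorph.locallyPathConnectedSpace {X Y : Type*} [TopologicalSpace X]
    [TopologicalSpace Y] (e : X ≃ₜ Y) [LocallyPathConnectedSpace Y] :
    LocallyPathConnectedSpace X :=
  e.symm.isQuotientMap.locallyPathConnectedSpace

/-- A covering has a section over a simply connected, locally path connected set, through any
given point. -/
theorem IsCoveringMapOn.exists_section {X B : Type*} [TopologicalSpace X] [TopologicalSpace B]
    {p : X → B} {A : Set B} (hp : IsCoveringMapOn p A) [SimplyConnectedSpace A]
    [LocallyPathConnectedSpace A] {x : X} (hx : p x ∈ A) :
    ∃ σ : C(A, X), σ ⟨p x, hx⟩ = x ∧ ∀ a, p (σ a) = a := by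
  obtain ⟨σ, ⟨h₁, h₂⟩, -⟩ := hp.existsUnique_continuousMap_lifts
    (⟨Subtype.val, by fun_prop⟩ : C(A, B)) (a₀ := ⟨p x, hx⟩) (e₀ := x) rfl fun a => a.2
  exact ⟨σ, h₁, fun a => congrFun h₂ a⟩

/-- A covering is injective on preconnected sets over a simply connected, locally path connected
set. -/
theorem IsCoveringMapOn.injOn_of_isPreconnected {X B : Type*} [TopologicalSpace X]
    [TopologicalSpace B] {p : X → B} {A : Set B} (hp : IsCoveringMapOn p A)
    [SimplyConnectedSpace A] [LocallyPathConnectedSpace A] {C : Set X} (hC : IsPreconnected C)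
    (hCA : C ⊆ p ⁻¹' A) : InjOn p C := by
  intro x hx x' hx' hxx'
  obtain ⟨σ, h₁, h₂⟩ := hp.exists_section (hCA hx)
  have hcov := hp.isCoveringMap_restrictPreimage
  have : PreconnectedSpace C := isPreconnected_iff_preconnectedSpace.mp hC
  have hpc : Continuous fun c : C => A.restrictPreimage p ⟨c, hCA c.2⟩ :=
    hcov.continuous.comp (by fun_prop)
  -- The inclusion of `C` and `σ ∘ p` are two lifts of `p` on the connected set `C` that agree at
  -- `x`; so they coincide, and `p` determines the point.
  have heq := hcov.eq_of_comp_eq (A := C) (g₁ := fun c => ⟨c, hCA c.2⟩)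
    (g₂ := fun c => ⟨σ (A.restrictPreimage p ⟨c, hCA c.2⟩), by
      rw [mem_preimage, h₂]; exact Subtype.coe_prop _⟩)
    (by fun_prop) (by fun_prop) (by ext c; simp [h₂]) ⟨x, hx⟩ (Subtype.ext h₁.symm)
  have e₁ : x' = σ (A.restrictPreimage p ⟨x', hCA hx'⟩) :=
    congrArg Subtype.val (congrFun heq ⟨x', hx'⟩)
  rw [e₁, ← h₁]
  exact congrArg σ (Subtype.ext hxx')

/-! ### Arcs, and complements of locally straight sets -/

/-- An arc without self-intersections whose end points lie off its interior is a homeomorphism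
from the open interval onto its interior. -/
theorem nonempty_homeomorph_image_Ioo {T : Type*} [TopologicalSpace T] [T2Space T] {f : ℝ → T}
    (hc : ContinuousOn f (Icc 0 1)) (hf : InjOn f (Ioo 0 1)) (h0 : f 0 ∉ f '' Ioo 0 1)
    (h1 : f 1 ∉ f '' Ioo 0 1) : Nonempty (f '' Ioo 0 1 ≃ₜ Ioo (0 : ℝ) 1) := by
  set A := f '' Ioo 0 1 with hA
  -- Compactness of `[0, 1]` makes `f` closed, and this survives restriction over `A`, whose
  -- preimage is exactly `(0, 1)`.
  have hcl : IsClosedMap (A.restrictPreimage ((Icc (0 : ℝ) 1).domRestrict f)) :=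
    (continuousOn_iff_continuous_domRestrict.mp hc).isClosedMap.restrictPreimage A
  have hmem : ∀ x : (Icc (0 : ℝ) 1).domRestrict f ⁻¹' A, (x : ℝ) ∈ Ioo (0 : ℝ) 1 := by
    rintro ⟨⟨t, ht0, ht1⟩, hx⟩
    refine ⟨lt_of_le_of_ne ht0 ?_, lt_of_le_of_ne ht1 ?_⟩
    · rintro rfl; exact h0 hx
    · rintro rfl; exact h1 hx
  let e : Ioo (0 : ℝ) 1 ≃ₜ (Icc (0 : ℝ) 1).domRestrict f ⁻¹' A :=
    { toFun := fun t => ⟨⟨t, Ioo_subset_Icc_self t.2⟩, ⟨t, t.2, rfl⟩⟩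
      invFun := fun x => ⟨x, hmem x⟩
      left_inv := fun t => rfl
      right_inv := fun x => rfl
      continuous_toFun := by fun_prop
      continuous_invFun := by fun_prop }
  have hh : IsHomeomorph (A.restrictPreimage ((Icc (0 : ℝ) 1).domRestrict f)) := by
    rw [isHomeomorph_iff_continuous_isClosedMap_bijective]
    refine ⟨(continuousOn_iff_continuous_domRestrict.mp hc).restrictPreimage, hcl, ?_, ?_⟩
    · intro x y hxy
      exact Subtype.ext (Subtype.ext (hf (hmem x) (hmem y) (congrArg Subtype.val hxy)))
    · rintro ⟨_, t, ht, rfl⟩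
      exact ⟨e ⟨t, ht⟩, rfl⟩
  exact ⟨(hh.homeomorph).symm.trans e.symm⟩

open Filter Topology in
/-- If the set `L` is a straight line in a chart at `z`, then a component of `Lᶜ` that accumulates
at `z` accumulates at all points of `L` near `z`. -/
theorem exists_isOpen_inter_subset_closure {X : Type*} [TopologicalSpace X] {L Q : Set X}
    (Ψ : OpenPartialHomeomorph X ℂ) (hΨ : ∀ x ∈ Ψ.source, x ∈ L ↔ (Ψ x).im = 0)
    (hQL : Q ⊆ Lᶜ) (hQ : ∀ P ⊆ Lᶜ, IsPreconnected P → (P ∩ Q).Nonempty → P ⊆ Q)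
    {z : X} (hz : z ∈ Ψ.source) (hzQ : z ∈ closure Q) :
    ∃ V, IsOpen V ∧ z ∈ V ∧ V ∩ L ⊆ closure Q := by
  obtain ⟨r, hr, hB⟩ := Metric.isOpen_iff.mp Ψ.open_target _ (Ψ.map_source hz)
  set B := Metric.ball (Ψ z) r with hBdef
  have hV : IsOpen (Ψ.source ∩ Ψ ⁻¹' B) := Ψ.isOpen_inter_preimage Metric.isOpen_ball
  have hzV : z ∈ Ψ.source ∩ Ψ ⁻¹' B := ⟨hz, Metric.mem_ball_self hr⟩
  refine ⟨_, hV, hzV, ?_⟩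
  obtain ⟨q, ⟨hqs, hqB⟩, hqQ⟩ := mem_closure_iff.mp hzQ _ hV hzV
  have hq0 : (Ψ q).im ≠ 0 := fun h => hQL hqQ ((hΨ q hqs).mpr h)
  set a := (Ψ q).im with ha
  -- The side of the line on which `q` lies: the half disc `B ∩ H` is convex and misses the line, so
  -- it pulls back into `Q`, and each point of the line in `B` is a limit from that side.
  set H : Set ℂ := {w | 0 < a * w.im} with hH
  have hHB : IsPreconnected (B ∩ H) := by
    refine (Convex.inter (convex_ball _ _) ?_).isPreconnected
    exact convex_halfSpace_gt (f := fun w : ℂ => a * w.im)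
      ⟨fun x y => by simp [mul_add], fun c x => by simp; ring⟩ 0
  have hPQ : Ψ.symm '' (B ∩ H) ⊆ Q := by
    refine hQ _ ?_ (hHB.image _ (Ψ.continuousOn_symm.mono (inter_subset_left.trans hB)))
      ⟨q, ⟨Ψ q, ⟨hqB, mul_self_pos.mpr hq0⟩, Ψ.left_inv hqs⟩, hqQ⟩
    rintro _ ⟨w, ⟨hwB, hwH⟩, rfl⟩ hwL
    rw [hΨ _ (Ψ.map_target (hB hwB)), Ψ.right_inv (hB hwB)] at hwL
    simp [hH, hwL] at hwH
  rintro x ⟨⟨hxs, hxB⟩, hxL⟩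
  have hx0 := (hΨ x hxs).mp hxL
  have hlim : Tendsto (fun t : ℝ => Ψ x + (t * a : ℝ) * Complex.I) (𝓝[>] 0) (𝓝 (Ψ x)) := by
    have : Continuous (fun t : ℝ => Ψ x + (t * a : ℝ) * Complex.I) := by fun_prop
    simpa using (this.tendsto 0).mono_left nhdsWithin_le_nhds
  have hlim' := ((Ψ.continuousAt_symm (Ψ.map_source hxs)).tendsto).comp hlim
  rw [Ψ.left_inv hxs] at hlim'
  refine mem_closure_of_tendsto hlim' ?_
  filter_upwards [hlim (Metric.isOpen_ball.mem_nhds hxB), self_mem_nhdsWithin] with t htB ht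
  refine hPQ ⟨_, ⟨htB, ?_⟩, rfl⟩
  have : 0 < t * (a * a) := mul_pos ht (mul_self_pos.mpr hq0)
  simp only [hH, mem_ofPred_eq, Complex.add_im, hx0, Complex.mul_I_im, Complex.ofReal_re]
  linarith

/-- If the set `L` is a straight line in suitable charts at the points of a connected subset `e`,
then a component of `Lᶜ` that accumulates at one point of `e` accumulates at all of them. -/
theorem IsPreconnected.subset_closure_of_charts {X : Type*} [TopologicalSpace X] {L Q e : Set X}
    (he : IsPreconnected e) (heL : e ⊆ L)
    (hΨ : ∀ z ∈ e, ∃ Ψ : OpenPartialHomeomorph X ℂ, z ∈ Ψ.source ∧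
      ∀ x ∈ Ψ.source, x ∈ L ↔ (Ψ x).im = 0)
    (hQL : Q ⊆ Lᶜ) (hQ : ∀ P ⊆ Lᶜ, IsPreconnected P → (P ∩ Q).Nonempty → P ⊆ Q)
    {y : X} (hy : y ∈ e) (hyQ : y ∈ closure Q) : e ⊆ closure Q := by
  -- This open set and the complement of `closure Q` cover `e` and are disjoint on it, so
  -- connectedness leaves only one of them.
  have hU : IsOpen {z | ∃ V, IsOpen V ∧ z ∈ V ∧ V ∩ L ⊆ closure Q} :=
    isOpen_iff_forall_mem_open.mpr fun z ⟨V, hV, hzV, h⟩ => ⟨V, fun w hw => ⟨V, hV, hw, h⟩, hV, hzV⟩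
  have hcover : e ⊆ {z | ∃ V, IsOpen V ∧ z ∈ V ∧ V ∩ L ⊆ closure Q} ∪ (closure Q)ᶜ := by
    intro z hz
    by_cases hzQ : z ∈ closure Q
    · obtain ⟨Ψ, hzΨ, h⟩ := hΨ z hz
      exact .inl (exists_isOpen_inter_subset_closure Ψ h hQL hQ hzΨ hzQ)
    · exact .inr hzQ
  have hsub : e ∩ {z | ∃ V, IsOpen V ∧ z ∈ V ∧ V ∩ L ⊆ closure Q} ⊆ closure Q :=
    fun z ⟨hz, V, _, hzV, h⟩ => h ⟨hzV, heL hz⟩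
  rcases isPreconnected_iff_subset_of_disjoint.mp he _ _ hU isClosed_closure.isOpen_compl hcover
    (eq_empty_of_forall_notMem fun z ⟨hz, hz₁, hz₂⟩ => hz₂ (hsub ⟨hz, hz₁⟩)) with h | h
  · exact fun z hz => hsub ⟨hz, h hz⟩
  · exact absurd hyQ (h hy)

/-- A regular smooth plane curve can be straightened locally. -/
theorem exists_openPartialHomeomorph_eq_curve {c : ℝ → ℂ} {u : ℝ} (hc : ContDiffAt ℝ ∞ c u)
    (hv : deriv c u ≠ 0) :
    ∃ e : OpenPartialHomeomorph ℂ ℂ, (u : ℂ) ∈ e.source ∧ ∀ t : ℝ, e t = c t := by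
  set v := deriv c u
  -- The curve is thickened in the normal direction `i v`. The derivative at `u` is multiplication
  -- by `v`, so the inverse function theorem applies.
  have hd : HasStrictFDerivAt (fun w : ℂ => c w.re + w.im * (Complex.I * v))
      ((ContinuousLinearEquiv.smulLeft (R₁ := ℝ) (M₁ := ℂ) (Units.mk0 v hv) : ℂ ≃L[ℝ] ℂ) :
        ℂ →L[ℝ] ℂ) (u : ℂ) := by
    have h₁ : HasStrictDerivAt c v ((u : ℂ).re) := hc.hasStrictDerivAt (by simp)
    have h₂ := h₁.hasStrictFDerivAt.comp (u : ℂ) Complex.reCLM.hasStrictFDerivAt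
    have h₃ := ((Complex.ofRealCLM.comp Complex.imCLM).hasStrictFDerivAt (x := (u : ℂ))).mul_const
      (Complex.I * v)
    refine (h₂.add h₃).congr_fderiv ?_
    refine ContinuousLinearMap.ext fun w => ?_
    have hw : v * (w.re : ℂ) + (w.im : ℂ) * (Complex.I * v) = w * v := by
      conv_rhs => rw [← Complex.re_add_im w]
      ring
    simpa [mul_comm] using hw
  exact ⟨hd.toOpenPartialHomeomorph _, hd.mem_toOpenPartialHomeomorph_source, fun t => by simp⟩

/-! ### Local and global topology of a cut system -/

namespace CutSystem

section

variable {T : Type*} [TopologicalSpace T] [ChartedSpace ℂ T] {C : Set T} (E : CutSystem T C)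

theorem openEdge_subset_carrier (i : Fin E.k) : E.openEdge i ⊆ E.carrier :=
  (image_mono Ioo_subset_Icc_self).trans
    ((subset_iUnion (fun i => E.arc i '' Icc 0 1) i).trans subset_union_right)

theorem conePoints_subset_carrier : C ⊆ E.carrier :=
  E.conePoints_subset.trans subset_union_left

theorem disjoint_openEdge_vertices (i : Fin E.k) : Disjoint (E.openEdge i) E.vertices := by
  rw [disjoint_left]
  rintro _ ⟨t, ht, rfl⟩
  exact E.arc_notMem i t ht

theorem mem_vertices_or_mem_Ioo (i : Fin E.k) {t : ℝ} (ht : t ∈ Icc (0 : ℝ) 1) :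
    E.arc i t ∈ E.vertices ∨ t ∈ Ioo (0 : ℝ) 1 := by
  rcases eq_or_lt_of_le ht.1 with rfl | h0
  · exact .inl (E.arc_zero_mem i)
  rcases eq_or_lt_of_le ht.2 with rfl | h1
  · exact .inl (E.arc_one_mem i)
  exact .inr ⟨h0, h1⟩

theorem continuousOn_arc (i : Fin E.k) : ContinuousOn (E.arc i) (Icc 0 1) :=
  (E.arc_mdifferentiableOn i).continuousOn

theorem contDiffAt_chartAt_comp_arc (i : Fin E.k) {u : ℝ} (hu : u ∈ Ioo (0 : ℝ) 1) :
    ContDiffAt ℝ ∞ (chartAt ℂ (E.arc i u) ∘ E.arc i) u := by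
  have h := (E.arc_smooth i).contMDiffAt (isOpen_Ioo.mem_nhds hu)
  have h' := (contMDiffAt_iff_target.mp h).2
  rw [contMDiffAt_iff_contDiffAt] at h'
  simpa only [mfld_simps] using h'

theorem deriv_chartAt_comp_arc_ne_zero (i : Fin E.k) {u : ℝ} (hu : u ∈ Ioo (0 : ℝ) 1) :
    deriv (chartAt ℂ (E.arc i u) ∘ E.arc i) u ≠ 0 := by
  have hv := E.velocity_ne_zero i u (Ioo_subset_Icc_self hu)
  have hn : Icc (0 : ℝ) 1 ∈ nhds u := Icc_mem_nhds hu.1 hu.2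
  have hd := (E.arc_mdifferentiableOn i u (Ioo_subset_Icc_self hu)).mdifferentiableAt hn
  rw [arcVelocity, mfderivWithin_of_mem_nhds hn, hd.mfderiv] at hv
  rw [← fderiv_apply_one_eq_deriv]
  simp only [mfld_simps, fderivWithin_univ, writtenInExtChartAt, chartAt_self_eq,
    Function.comp_def] at hv
  exact hv

/-- Near an interior point of an edge there is a chart in which the graph is a straight line. -/
theorem exists_openPartialHomeomorph_im_eq_zero [T2Space T] (i : Fin E.k) {z : T}
    (hz : z ∈ E.openEdge i) :
    ∃ Ψ : OpenPartialHomeomorph T ℂ, z ∈ Ψ.source ∧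
      ∀ x ∈ Ψ.source, x ∈ E.carrier ↔ (Ψ x).im = 0 := by
  obtain ⟨u, hu, rfl⟩ := hz
  set φ := chartAt ℂ (E.arc i u) with hφ
  obtain ⟨e, hue, he⟩ := exists_openPartialHomeomorph_eq_curve
    (E.contDiffAt_chartAt_comp_arc i hu) (E.deriv_chartAt_comp_arc_ne_zero i hu)
  have hzφ : E.arc i u ∈ φ.source := mem_chart_source ℂ _
  have hJ : {t : ℝ | E.arc i t ∈ φ.source ∧ (t : ℂ) ∈ e.source} ∩ Ioo 0 1 ∈ nhds u := by
    refine Filter.inter_mem (Filter.inter_mem ?_ ?_) (isOpen_Ioo.mem_nhds hu)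
    · exact ((E.continuousOn_arc i).continuousAt (Icc_mem_nhds hu.1 hu.2))
        (φ.open_source.mem_nhds hzφ)
    · exact Complex.continuous_ofReal.continuousAt (e.open_source.mem_nhds hue)
  obtain ⟨J, hJs, hJo, huJ⟩ := mem_nhds_iff.mp hJ
  -- The part of the graph to be kept away from `z`: it is closed, misses `z`, and off it the graph
  -- is just the arc over `J`.
  set K : Set T := E.vertices ∪ (⋃ j : {j // j ≠ i}, E.arc j '' Icc 0 1) ∪
    E.arc i '' (Icc 0 1 \ J) with hK
  have hKc : IsClosed K := by
    rw [hK]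
    refine (E.vertices.finite_toSet.isClosed.union (isClosed_iUnion_of_finite
      fun j : {j // j ≠ i} =>
      (isCompact_Icc.image_of_continuousOn (E.continuousOn_arc j.1)).isClosed)).union ?_
    exact ((isCompact_Icc.diff hJo).image_of_continuousOn
      ((E.continuousOn_arc i).mono sdiff_subset)).isClosed
  have hzK : E.arc i u ∉ K := by
    rintro ((h | h) | ⟨t, ⟨ht, htJ⟩, h⟩)
    · exact E.arc_notMem i u hu h
    · obtain ⟨⟨j, hj⟩, t, ht, h⟩ := mem_iUnion.mp h
      rcases E.mem_vertices_or_mem_Ioo j ht with hv | ht'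
      · exact E.arc_notMem i u hu (h ▸ hv)
      · exact disjoint_left.mp (E.arc_disjoint j i hj) ⟨t, ht', rfl⟩ ⟨u, hu, h.symm⟩
    · rcases E.mem_vertices_or_mem_Ioo i ht with hv | ht'
      · exact E.arc_notMem i u hu (h ▸ hv)
      · exact htJ (E.arc_injOn i ht' hu h ▸ huJ)
  have hsymm : ∀ t ∈ J, e.symm (φ (E.arc i t)) = t := fun t ht => by
    rw [← e.left_inv (hJs ht).1.2, he]; rfl
  -- Real parts are confined to `J` so that every real value of the chart is the parameter of an
  -- actual point of the arc.
  have hW : IsOpen ((φ.trans e.symm).source ∩ (φ.trans e.symm) ⁻¹' (Complex.re ⁻¹' J)) :=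
    (φ.trans e.symm).isOpen_inter_preimage (hJo.preimage Complex.continuous_re)
  refine ⟨(φ.trans e.symm).restrOpen _ (hW.inter hKc.isOpen_compl), ?_, ?_⟩
  · have hs : E.arc i u ∈ (φ.trans e.symm).source := by
      rw [OpenPartialHomeomorph.trans_source]
      refine ⟨hzφ, ?_⟩
      have := e.map_source hue
      rwa [he] at this
    rw [OpenPartialHomeomorph.restrOpen_source]
    refine ⟨hs, ⟨hs, ?_⟩, hzK⟩
    simpa [hsymm u huJ] using huJ
  · rintro x hx
    rw [OpenPartialHomeomorph.restrOpen_source] at hx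
    obtain ⟨-, ⟨hxs, hxJ⟩, hxK⟩ := hx
    rw [OpenPartialHomeomorph.trans_source] at hxs
    change _ ↔ (e.symm (φ x)).im = 0
    replace hxJ : (e.symm (φ x)).re ∈ J := hxJ
    constructor
    · rintro (h | h)
      · exact absurd (.inl (.inl h)) hxK
      · obtain ⟨j, t, ht, rfl⟩ := mem_iUnion.mp h
        by_cases hj : j = i
        · subst hj
          by_cases htJ : t ∈ J
          · rw [hsymm t htJ, Complex.ofReal_im]
          · exact absurd (.inr ⟨t, ⟨ht, htJ⟩, rfl⟩) hxK
        · exact absurd (.inl (.inr (mem_iUnion.mpr ⟨⟨j, hj⟩, t, ht, rfl⟩))) hxK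
    · intro h
      set t := (e.symm (φ x)).re with ht
      have h' : e.symm (φ x) = (t : ℂ) := Complex.ext (by simp [ht]) (by simp [h])
      have h'' : φ x = φ (E.arc i t) := by
        rw [← e.right_inv hxs.2, h', he]; rfl
      rw [φ.injOn hxs.1 (hJs hxJ).1.1 h'']
      exact E.openEdge_subset_carrier i ⟨t, (hJs hxJ).2, rfl⟩

theorem nonempty_homeomorph_openEdge [T2Space T] (i : Fin E.k) :
    Nonempty (E.openEdge i ≃ₜ Ioo (0 : ℝ) 1) :=
  nonempty_homeomorph_image_Ioo (E.continuousOn_arc i) (E.arc_injOn i)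
    (fun h => disjoint_left.mp (E.disjoint_openEdge_vertices i) h (E.arc_zero_mem i))
    (fun h => disjoint_left.mp (E.disjoint_openEdge_vertices i) h (E.arc_one_mem i))

theorem simplyConnectedSpace_openEdge [T2Space T] (i : Fin E.k) :
    SimplyConnectedSpace (E.openEdge i) := by
  have : ContractibleSpace (Ioo (0 : ℝ) 1) :=
    (convex_Ioo 0 1).contractibleSpace ⟨1 / 2, by norm_num⟩
  exact (E.nonempty_homeomorph_openEdge i).some.simplyConnectedSpace

theorem locallyPathConnectedSpace_openEdge [T2Space T] (i : Fin E.k) :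
    LocallyPathConnectedSpace (E.openEdge i) := by
  have := isOpen_Ioo (a := (0 : ℝ)) (b := 1) |>.locallyPathConnectedSpace
  exact (E.nonempty_homeomorph_openEdge i).some.locallyPathConnectedSpace

theorem simplyConnectedSpace_compl : SimplyConnectedSpace ↥E.carrierᶜ := by
  have : ContractibleSpace (Metric.ball (0 : ℂ) 1) :=
    (convex_ball 0 1).contractibleSpace ⟨0, by simp⟩
  exact E.compl_disc.some.simplyConnectedSpace

theorem locallyPathConnectedSpace_compl : LocallyPathConnectedSpace ↥E.carrierᶜ := by
  have := (Metric.isOpen_ball (x := (0 : ℂ)) (ε := 1)).locallyPathConnectedSpace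
  exact E.compl_disc.some.locallyPathConnectedSpace

end

end CutSystem

/-! ### The group action on components of preimages -/

namespace OrbitSurface

variable {G S : Type*} [Group G] [MulAction G S]

theorem proj_smul (g : G) (x : S) : proj G (g • x) = proj G x :=
  Quotient.sound ⟨g, rfl⟩

theorem exists_smul_eq_of_proj_eq {x y : S} (h : proj G x = proj G y) : ∃ g : G, g • y = x :=
  Quotient.exact h

theorem eq_one_of_smul_eq {x : S} (hx : proj G x ∉ conePoints G S) {g : G} (hg : g • x = x) :
    g = 1 := by
  by_contra hne
  refine hx ⟨x, fun h => hne ?_, rfl⟩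
  rwa [← MulAction.mem_stabilizer_iff, h, Subgroup.mem_bot] at hg

variable [TopologicalSpace S]

theorem isCoveringMapOn_proj [Finite G] [T2Space S] [LocallyCompactSpace S]
    [ContinuousConstSMul G S] :
    IsCoveringMapOn (proj G : S → OrbitSurface G S) (conePoints G S)ᶜ := by
  refine (isCoveringMapOn_quotientMk_of_properlyDiscontinuousSMul (G := G) (E := S)).mono ?_
  intro t ht
  obtain ⟨x, rfl⟩ := Quotient.exists_rep t
  refine ⟨x, ?_, rfl⟩
  by_contra hne
  exact ht ⟨x, hne, rfl⟩

theorem smul_image_connectedComponentIn [ContinuousConstSMul G S] (g : G)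
    {B : Set (OrbitSurface G S)} {x : S} (hx : proj G x ∈ B) :
    (g • ·) '' connectedComponentIn (proj G ⁻¹' B) x =
      connectedComponentIn (proj G ⁻¹' B) (g • x) := by
  have h := (Homeomorph.smul g).image_connectedComponentIn (s := proj G ⁻¹' B) hx
  have hB : Homeomorph.smul g '' (proj G ⁻¹' B) = proj G ⁻¹' B := by
    ext y
    constructor
    · rintro ⟨z, hz, rfl⟩
      simpa [proj_smul] using hz
    · intro hy
      exact ⟨g⁻¹ • y, by simpa [proj_smul] using hy, by simp⟩
  rw [hB] at h
  exact h

theorem smul_mem_closure_connectedComponentIn [ContinuousConstSMul G S] (g : G)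
    {B : Set (OrbitSurface G S)} {x y : S} (hx : proj G x ∈ B)
    (hy : y ∈ closure (connectedComponentIn (proj G ⁻¹' B) x)) :
    g • y ∈ closure (connectedComponentIn (proj G ⁻¹' B) (g • x)) := by
  rw [← smul_image_connectedComponentIn g hx]
  exact image_closure_subset_closure_image (continuous_const_smul g) ⟨y, hy, rfl⟩

/-- Each component maps injectively to `B`, so it meets every orbit at most once. This separates
both polygons and lifted edges. -/
theorem smul_eq_of_connectedComponentIn_eq [Finite G] [T2Space S] [LocallyCompactSpace S]
    [ContinuousConstSMul G S] {B : Set (OrbitSurface G S)} (hB : B ⊆ (conePoints G S)ᶜ)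
    [SimplyConnectedSpace B] [LocallyPathConnectedSpace B] {x y : S} (hx : proj G x ∈ B)
    (hxy : proj G x = proj G y)
    (h : connectedComponentIn (proj G ⁻¹' B) x = connectedComponentIn (proj G ⁻¹' B) y) :
    x = y :=
  (isCoveringMapOn_proj.mono hB).injOn_of_isPreconnected isPreconnected_connectedComponentIn
    (connectedComponentIn_subset _ _) (mem_connectedComponentIn hx)
    (h ▸ mem_connectedComponentIn (hxy ▸ hx : proj G y ∈ B)) hxy

/-- Over a simply connected set of regular points the group permutes the components of the
preimage transitively. -/
theorem exists_connectedComponentIn_smul_eq [Finite G] [T2Space S] [LocallyCompactSpace S]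
    [ContinuousConstSMul G S] {B : Set (OrbitSurface G S)} (hB : B ⊆ (conePoints G S)ᶜ)
    [SimplyConnectedSpace B] [LocallyPathConnectedSpace B] {x₀ x : S} (hx₀ : proj G x₀ ∈ B)
    (hx : proj G x ∈ B) :
    ∃ g : G, connectedComponentIn (proj G ⁻¹' B) x =
      connectedComponentIn (proj G ⁻¹' B) (g • x₀) := by
  -- The image of `σ` is a connected sheet through `x₀` meeting every orbit over `B`; `g` carries
  -- its point in the orbit of `x` to `x`.
  obtain ⟨σ, h₁, h₂⟩ := (isCoveringMapOn_proj.mono hB).exists_section hx₀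
  obtain ⟨g, hg⟩ := exists_smul_eq_of_proj_eq (G := G) (h₂ ⟨proj G x, hx⟩).symm
  refine ⟨g, ?_⟩
  have hσ : range σ ⊆ connectedComponentIn (proj G ⁻¹' B) x₀ := by
    refine (isPreconnected_range σ.continuous).subset_connectedComponentIn ⟨_, h₁⟩ ?_
    rintro _ ⟨a, rfl⟩
    rw [mem_preimage, h₂]
    exact a.2
  have hmem : x ∈ connectedComponentIn (proj G ⁻¹' B) (g • x₀) := by
    rw [← smul_image_connectedComponentIn g hx₀]
    exact ⟨_, hσ ⟨⟨proj G x, hx⟩, rfl⟩, hg⟩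
  exact (connectedComponentIn_eq hmem).symm

end OrbitSurface

/-! ### Polygons and edges of the lifted tiling -/

namespace CutSystem

open OrbitSurface

variable {G S : Type*} [Group G] [MulAction G S] [TopologicalSpace S]
  [ChartedSpace ℂ (OrbitSurface G S)]
  (E : CutSystem (OrbitSurface G S) (conePoints G S))

theorem compl_carrier_subset_compl_conePoints : E.carrierᶜ ⊆ (conePoints G S)ᶜ :=
  compl_subset_compl.mpr E.conePoints_subset_carrier

theorem openEdge_subset_compl_conePoints (i : Fin E.k) : E.openEdge i ⊆ (conePoints G S)ᶜ :=
  fun _ hx hC => disjoint_left.mp (E.disjoint_openEdge_vertices i) hx (E.conePoints_subset hC)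

/-- If a polygon contains a point of an open edge of the tiling, then it contains that edge. -/
theorem connectedComponentIn_openEdge_subset_closure [Finite G] [T2Space S]
    [LocallyCompactSpace S] [ContinuousConstSMul G S] (i : Fin E.k) {x y : S}
    (hy : proj G y ∈ E.openEdge i) (hyx : y ∈ closure (connectedComponentIn E.liftᶜ x)) :
    connectedComponentIn (proj G ⁻¹' E.openEdge i) y ⊆
      closure (connectedComponentIn E.liftᶜ x) := by
  have hsub := connectedComponentIn_subset (proj G ⁻¹' E.openEdge i) y
  refine IsPreconnected.subset_closure_of_charts (L := E.lift)
    isPreconnected_connectedComponentIn (hsub.trans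
      (preimage_mono (E.openEdge_subset_carrier i))) ?_ (connectedComponentIn_subset _ _) ?_
    (mem_connectedComponentIn hy) hyx
  · intro z hz
    obtain ⟨Ψ, hzΨ, hΨ⟩ := E.exists_openPartialHomeomorph_im_eq_zero i (hsub hz)
    -- Over regular points `proj` is a local homeomorphism, so the straightening chart pulls back to
    -- `S`.
    obtain ⟨f, hzf, hf⟩ := (isCoveringMapOn_proj (G := G) (S := S)).isLocalHomeomorphOn z
      (E.openEdge_subset_compl_conePoints i (hsub hz))
    refine ⟨f.trans Ψ, ?_, fun w hw => ?_⟩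
    · rw [OpenPartialHomeomorph.trans_source]
      exact ⟨hzf, by rw [mem_preimage, ← hf]; exact hzΨ⟩
    · rw [OpenPartialHomeomorph.trans_source, mem_inter_iff, mem_preimage, ← hf] at hw
      rw [OpenPartialHomeomorph.trans_apply, ← hf]
      exact hΨ _ hw.2
  · rintro P hPL hP ⟨q, hqP, hqQ⟩
    rw [connectedComponentIn_eq hqQ]
    exact hP.subset_connectedComponentIn hqP hPL

/-- Where the lift of a loop crosses the tiling, the polygons of its end points meet. -/
theorem exists_mem_closure_inter_of_liftsTo {x₀ : S} (hx₀ : proj G x₀ ∉ E.carrier)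
    {γ : Path (proj G x₀) (proj G x₀)} {s : unitInterval}
    (hs : ∀ t, γ t ∈ E.carrier → t = s) (hγs : γ s ∈ E.carrier) {h : G}
    (hlift : LiftsTo x₀ γ h) :
    ∃ y, proj G y = γ s ∧ y ∈ closure (connectedComponentIn E.liftᶜ x₀) ∧
      y ∈ closure (connectedComponentIn E.liftᶜ (h • x₀)) := by
  obtain ⟨γ', hγ'⟩ := hlift
  have hne : ∀ t, t ≠ s → γ' t ∈ E.liftᶜ := fun t ht hmem => ht (hs t (by rw [← hγ' t]; exact hmem))
  -- The crossing time is interior, so the lift splits into two nonempty pieces, one in the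
  -- component of `x₀` and one in that of `h • x₀`, both with `γ' s` as limit.
  have h0 : (0 : unitInterval) < s := unitInterval.pos_iff_ne_zero.mpr fun h => by
    rw [h, γ.source] at hγs; exact hx₀ hγs
  have h1 : s < 1 := unitInterval.lt_one_iff_ne_one.mpr fun h => by
    rw [h, γ.target] at hγs; exact hx₀ hγs
  refine ⟨γ' s, hγ' s, ?_, ?_⟩
  · have hsub : γ' '' Iio s ⊆ connectedComponentIn E.liftᶜ x₀ := by
      refine (isPreconnected_Iio.image _ γ'.continuous.continuousOn).subset_connectedComponentIn
        ⟨0, h0, γ'.source⟩ ?_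
      rintro _ ⟨t, ht, rfl⟩
      exact hne t (ne_of_lt ht)
    refine closure_mono hsub (image_closure_subset_closure_image γ'.continuous ⟨s, ?_, rfl⟩)
    rw [closure_Iio' (a := s) ⟨0, h0⟩]
    exact self_mem_Iic
  · have hsub : γ' '' Ioi s ⊆ connectedComponentIn E.liftᶜ (h • x₀) := by
      refine (isPreconnected_Ioi.image _ γ'.continuous.continuousOn).subset_connectedComponentIn
        ⟨1, h1, γ'.target⟩ ?_
      rintro _ ⟨t, ht, rfl⟩
      exact hne t (ne_of_gt ht)
    refine closure_mono hsub (image_closure_subset_closure_image γ'.continuous ⟨s, ?_, rfl⟩)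
    rw [closure_Ioi' (a := s) ⟨1, h1⟩]
    exact self_mem_Ici

/-- A crossover transformation is the monodromy of a loop that meets the graph once, in the
interior of the edge. -/
theorem exists_crossover_eq_monodromy {x₀ : S} {δ : Fin E.k → Path (proj G x₀) (proj G x₀)}
    (hδ : ∀ i, E.IsCrossoverLoop i (δ i)) (e : Fin E.k × Bool) :
    ∃ (γ : Path (proj G x₀) (proj G x₀)) (s : unitInterval),
      E.crossover δ e = monodromy x₀ γ ∧ γ s ∈ E.openEdge e.1 ∧
        ∀ t, γ t ∈ E.carrier → t = s := by
  obtain ⟨s, hs, u, hu, hsu, honly, -⟩ := (hδ e.1).crosses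
  let s' : unitInterval := ⟨s, Ioo_subset_Icc_self hs⟩
  have hmem : δ e.1 s' ∈ E.openEdge e.1 :=
    ⟨u, hu, by rw [← hsu, (δ e.1).extend_apply (Ioo_subset_Icc_self hs)]⟩
  have huniq : ∀ t, δ e.1 t ∈ E.carrier → t = s' := fun t ht =>
    Subtype.ext (honly t t.2 (by rwa [(δ e.1).extend_apply t.2]))
  by_cases he : e.2
  · exact ⟨δ e.1, s', by simp [crossover, he], hmem, huniq⟩
  · refine ⟨(δ e.1).symm, unitInterval.symm s', by simp [crossover, he], by simpa using hmem,
      fun t ht => ?_⟩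
    rw [← huniq _ ht, unitInterval.symm_symm]

/-- If a crossover transformation is an involution, then every polygon meets some other polygon
in at least two edges. -/
theorem exists_two_le_encard_commonEdges [Finite G] [T2Space S] [LocallyCompactSpace S]
    [ContinuousConstSMul G S] {x₀ : S} (hx₀ : proj G x₀ ∉ E.carrier)
    {δ : Fin E.k → Path (proj G x₀) (proj G x₀)} (hδ : ∀ i, E.IsCrossoverLoop i (δ i))
    {e : Fin E.k × Bool} (he : orderOf (E.crossover δ e) = 2) {Q : Set S} (hQ : E.IsPolygon Q) :
    ∃ Q' : Set S, E.IsPolygon Q' ∧ Q' ≠ Q ∧ 2 ≤ (E.commonEdges Q Q').encard := by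
  obtain ⟨γ, s, hγ, hγs, hs⟩ := E.exists_crossover_eq_monodromy hδ e
  set h := E.crossover δ e
  set i := e.1
  have hh : h * h = 1 := by rw [← pow_two, ← he, pow_orderOf_eq_one]
  have h1 : h ≠ 1 := fun h1 => by rw [h1, orderOf_one] at he; omega
  have hlift : LiftsTo x₀ γ h := by
    rw [hγ]
    refine liftsTo_monodromy x₀ γ fun t ht => ?_
    rw [hs t (E.conePoints_subset_carrier ht)] at ht
    exact E.openEdge_subset_compl_conePoints i hγs ht
  obtain ⟨y, hyγ, hy₁, hy₂⟩ := E.exists_mem_closure_inter_of_liftsTo hx₀ hs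
    (E.openEdge_subset_carrier i hγs) hlift
  have hy : proj G y ∈ E.openEdge i := hyγ ▸ hγs
  have := E.simplyConnectedSpace_compl
  have := E.locallyPathConnectedSpace_compl
  have := E.simplyConnectedSpace_openEdge i
  have := E.locallyPathConnectedSpace_openEdge i
  have hfree : ∀ {z : S} (g : G), proj G z ∉ conePoints G S → g • z ≠ (g * h) • z := by
    intro z g hz hgz
    rw [mul_smul] at hgz
    exact h1 (eq_one_of_smul_eq hz (MulAction.injective g hgz).symm)
  have hx₀' : ∀ g : G, proj G (g • x₀) ∈ E.carrierᶜ := fun g => by rwa [proj_smul]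
  have hy' : ∀ g : G, proj G (g • y) ∈ E.openEdge i := fun g => by rwa [proj_smul]
  have hsmul : ∀ (g : G) {a z : S}, proj G a ∈ E.carrierᶜ →
      z ∈ closure (connectedComponentIn E.liftᶜ a) →
      g • z ∈ closure (connectedComponentIn E.liftᶜ (g • a)) := fun g _ _ ha hz =>
    smul_mem_closure_connectedComponentIn g ha hz
  obtain ⟨x, hx, rfl⟩ := hQ
  obtain ⟨g, hg⟩ := exists_connectedComponentIn_smul_eq
    E.compl_carrier_subset_compl_conePoints (x₀ := x₀) (x := x) hx₀ hx
  change connectedComponentIn E.liftᶜ x = connectedComponentIn E.liftᶜ (g • x₀) at hg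
  rw [hg]
  -- With `P` the component of `x₀` and `Q = gP`, the neighbour is `ghP`, and the shared edges pass
  -- through `g y` and `gh y`.
  refine ⟨connectedComponentIn E.liftᶜ ((g * h) • x₀), ⟨_, hx₀' _, rfl⟩, fun heq => ?_, ?_⟩
  · exact hfree g (E.compl_carrier_subset_compl_conePoints hx₀)
      (smul_eq_of_connectedComponentIn_eq E.compl_carrier_subset_compl_conePoints
        (hx₀' g) (by rw [proj_smul, proj_smul]) heq.symm)
  have hne : connectedComponentIn (proj G ⁻¹' E.openEdge i) (g • y) ≠
      connectedComponentIn (proj G ⁻¹' E.openEdge i) ((g * h) • y) := fun heq =>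
    hfree g (E.openEdge_subset_compl_conePoints i hy)
      (smul_eq_of_connectedComponentIn_eq (E.openEdge_subset_compl_conePoints i)
        (hy' g) (by rw [proj_smul, proj_smul]) heq)
  rw [← encard_pair hne]
  refine encard_le_encard (insert_subset ?_ (singleton_subset_iff.mpr ?_))
  · refine ⟨⟨i, _, hy' g, rfl⟩, subset_inter ?_ ?_⟩
    · exact E.connectedComponentIn_openEdge_subset_closure i (hy' g) (hsmul g hx₀ hy₁)
    · refine E.connectedComponentIn_openEdge_subset_closure i (hy' g) ?_
      rw [mul_smul]
      exact hsmul g (hx₀' h) hy₂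
  · refine ⟨⟨i, _, hy' (g * h), rfl⟩, subset_inter ?_ ?_⟩
    · refine E.connectedComponentIn_openEdge_subset_closure i (hy' _) ?_
      -- The involution enters here: `gh y` lies in the closure of `ghhP = gP`.
      have := hsmul (g * h) (hx₀' h) hy₂
      rwa [← mul_smul (g * h) h x₀, mul_assoc, hh, mul_one] at this
    · exact E.connectedComponentIn_openEdge_subset_closure i (hy' _) (hsmul (g * h) hx₀ hy₁)

end CutSystem
/-- Let the finite group `G` act conformally and faithfully on the closed connected Riemann
surface `S`, let `T = S / G` carry the complex structure that makes the quotient map holomorphic,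
and let `E` be a cut system on `T`. If the crossover sequence contains an involution, then every
polygon of the lifted tiling of `S` meets some other polygon in two or more edges. -/
theorem mainTheorem8 {S G : Type*} [TopologicalSpace S] [T2Space S] [CompactSpace S]
    [ConnectedSpace S] [ChartedSpace ℂ S] [IsManifold 𝓘(ℂ, ℂ) ω S]
    [Group G] [Finite G] [MulAction G S] [FaithfulSMul G S]
    (hG : ∀ g : G, MDifferentiable 𝓘(ℂ, ℂ) 𝓘(ℂ, ℂ) (fun x : S => g • x))
    [ChartedSpace ℂ (OrbitSurface G S)] [IsManifold 𝓘(ℂ, ℂ) ω (OrbitSurface G S)]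
    (hproj : MDifferentiable 𝓘(ℂ, ℂ) 𝓘(ℂ, ℂ) (OrbitSurface.proj G : S → OrbitSurface G S))
    (E : CutSystem (OrbitSurface G S) (OrbitSurface.conePoints G S))
    (x₀ : S) (hx₀ : OrbitSurface.proj G x₀ ∉ E.carrier)
    (δ : Fin E.k → Path (OrbitSurface.proj G x₀) (OrbitSurface.proj G x₀))
    (hδ : ∀ i, E.IsCrossoverLoop i (δ i))
    (ord : Fin (2 * E.k) ≃ Fin E.k × Bool)
    (hinv : ∃ j, orderOf (E.crossoverSequence δ ord j) = 2) :
    ∀ Q : Set S, E.IsPolygon Q →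
      ∃ Q' : Set S, E.IsPolygon Q' ∧ Q' ≠ Q ∧ 2 ≤ (E.commonEdges Q Q').encard := by
  have : ContinuousConstSMul G S := ⟨fun g => (hG g).continuous⟩
  have : LocallyCompactSpace S := ChartedSpace.locallyCompactSpace ℂ S
  obtain ⟨j, hj⟩ := hinv
  exact fun Q hQ => E.exists_two_le_encard_commonEdges hx₀ hδ hj hQ
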